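/- Let $X=\mathbb F_3[x]/(x^3)$ with its standard derivation $\partial_x=d/dx$, and let $T(X)=\bigoplus_{n\ge0}X^{\otimes n}$. Define linear operators $a,t$ on $T(X)$ recursively by $a\cdot 1=t\cdot 1=0$ and, for $y\in X$ and $v\in T(X)$, $$a\cdot(y\otimes v)=\partial_x y\otimes v,\qquad t\cdot(y\otimes v)=xy\otimes(a\cdot v)+x^2y\otimes(t\cdot v),$$ that is, through the self-similarity structure $a\mapsto\partial_x$, $t\mapsto x\otimes a+x^2\otimes t$. The Gupta–Sidki Lie algebra $\mathcal L$ is the Lie algebra over $\mathbb F_3$ of operators on $T(X)$ generated by $a$ and $t$, with bracket the commutator. **Theorem.** $\mathcal L$ is closed under $z\mapsto z^3$, hence is a restricted Lie algebra over $\mathbb F_3$, and: 1. $\mathcal L$ is nil: for every $z\in\mathcal L$ there is $n$ with $z^{3^n}=0$, and for every $z\in\mathcal L$ the endomorphism $\operatorname{ad}(z)$ of $\mathcal L$ is nilpotent. 2. The nillity of $\mathcal L$ is unbounded: for every $n$ there is $z\in\mathcal L$ with $z^{3^n}\ne0$, and for every $n$ there is $z\in\mathcal L$ with $\operatorname{ad}(z)^n\neq0$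 on $\mathcal L$. 3. $\mathcal L$ is not a nilpotent Lie algebra. Moreover it is not PI: for every non-zero Lie polynomial $P$ over $\mathbb F_3$ (a non-zero element of the free Lie algebra on countably many indeterminates, viewed inside the free associative algebra) there are elements $z_0,z_1,\dots\in\mathcal L$ with $P(z_0,z_1,\dots)\ne0$. -/

import Mathlib

open scoped Polynomial

-- Associative algebras carry the commutator bracket.
attribute [local instance 100] LieRing.ofAssociativeRing

namespace GuptaSidki

noncomputable section

/-- The alphabet `X = 𝔽₃[x]/(x³)`. -/
abbrev Alphabet : Type := AdjoinRoot (Polynomial.X ^ 3 : (ZMod 3)[X])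

/-- The class of `x` in the alphabet. -/
def x : Alphabet := AdjoinRoot.root (Polynomial.X ^ 3 : (ZMod 3)[X])

/-- The ideal `(x³)` of `𝔽₃[x]` is stable under differentiation. -/
theorem mk_derivative_eq_zero (q : (ZMod 3)[X])
    (hq : AdjoinRoot.mkₐ (Polynomial.X ^ 3 : (ZMod 3)[X]) q = 0) :
    AdjoinRoot.mkₐ (Polynomial.X ^ 3 : (ZMod 3)[X]) (Polynomial.derivative' q) = 0 := by
  have h : AdjoinRoot.mk (Polynomial.X ^ 3 : (ZMod 3)[X]) q = 0 := hq
  rw [AdjoinRoot.mk_eq_zero] at h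
  obtain ⟨r, rfl⟩ := h
  change AdjoinRoot.mk (Polynomial.X ^ 3 : (ZMod 3)[X]) (Polynomial.derivative _) = 0
  rw [AdjoinRoot.mk_eq_zero, Polynomial.derivative_mul, Polynomial.derivative_X_pow]
  have h3 : ((3 : ℕ) : ZMod 3) = 0 := by decide
  rw [h3]
  simp

/-- The standard derivation `∂ₓ = d/dx` of `X = 𝔽₃[x]/(x³)`. -/
def dx : Derivation (ZMod 3) Alphabet Alphabet :=
  Derivation.liftOfSurjective
    (f := AdjoinRoot.mkₐ (Polynomial.X ^ 3 : (ZMod 3)[X]))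
    (AdjoinRoot.mk_surjective (g := (Polynomial.X ^ 3 : (ZMod 3)[X])))
    (d := Polynomial.derivative') mk_derivative_eq_zero

theorem dx_mk (q : (ZMod 3)[X]) :
    dx (AdjoinRoot.mk (Polynomial.X ^ 3 : (ZMod 3)[X]) q) =
      AdjoinRoot.mk (Polynomial.X ^ 3 : (ZMod 3)[X]) (Polynomial.derivative q) :=
  Derivation.liftOfSurjective_apply
    (f := AdjoinRoot.mkₐ (Polynomial.X ^ 3 : (ZMod 3)[X]))
    (AdjoinRoot.mk_surjective (g := (Polynomial.X ^ 3 : (ZMod 3)[X])))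
    (d := Polynomial.derivative') mk_derivative_eq_zero q

/-- The space `T(X)` on which the Lie algebra acts: the tensor algebra of the module `X`. -/
abbrev Tens : Type := TensorAlgebra (ZMod 3) Alphabet

/-- Left tensor multiplication by a letter `y`, as a linear function of `y`. -/
def consLetter : Alphabet →ₗ[ZMod 3] Module.End (ZMod 3) Tens :=
  (LinearMap.mul (ZMod 3) Tens).comp (TensorAlgebra.ι (ZMod 3))

/-- One step of the simultaneous recursion for `(v, a · v, t · v)`: the letter `y` sends
`(v, v₁, v₂)` to `(y ⊗ v, ∂ₓ y ⊗ v, (x y) ⊗ v₁ + (x² y) ⊗ v₂)`. -/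
def recStep : Alphabet →ₗ[ZMod 3] Module.End (ZMod 3) (Tens × Tens × Tens) where
  toFun y :=
    ((consLetter y).comp (LinearMap.fst _ _ _)).prod
      (((consLetter (dx y)).comp (LinearMap.fst _ _ _)).prod
        (((consLetter (x * y)).comp ((LinearMap.fst _ _ _).comp (LinearMap.snd _ _ _))) +
          ((consLetter (x ^ 2 * y)).comp ((LinearMap.snd _ _ _).comp (LinearMap.snd _ _ _)))))
  map_add' y z := by
    ext <;> simp [mul_add]
  map_smul' c y := by
    ext <;> simp

/-- The triple `(v, a · v, t · v)` as a linear function of `v ∈ T(X)`. -/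
def recTriple : Tens →ₗ[ZMod 3] Tens × Tens × Tens :=
  (LinearMap.applyₗ ((1 : Tens), (0 : Tens), (0 : Tens))).comp
    (TensorAlgebra.lift (ZMod 3) recStep).toLinearMap

/-- The operator on `T(X)` by which the generator `a` with `ψ(a) = ∂ₓ` acts.
See `opA_one`, `opA_cons`. -/
def opA : Module.End (ZMod 3) Tens :=
  ((LinearMap.fst _ _ _).comp (LinearMap.snd _ _ _)).comp recTriple

/-- The operator on `T(X)` by which the generator `t` with `ψ(t) = x ⊗ a + x² ⊗ t` acts.
See `opT_one`, `opT_cons`. -/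
def opT : Module.End (ZMod 3) Tens :=
  ((LinearMap.snd _ _ _).comp (LinearMap.snd _ _ _)).comp recTriple

theorem recTriple_cons (y : Alphabet) (v : Tens) :
    recTriple (TensorAlgebra.ι (ZMod 3) y * v) = recStep y (recTriple v) := by
  simp [recTriple]

theorem recTriple_fst (v : Tens) : (recTriple v).1 = v := by
  have key : ∀ u w : Tens, ∀ s : Tens × Tens,
      (TensorAlgebra.lift (ZMod 3) recStep u (w, s)).1 = u * w := by
    intro u
    induction u using TensorAlgebra.induction with
    | algebraMap r => intro w s; simp [Algebra.smul_def, Module.algebraMap_end_apply]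
    | ι y => intro w s; simp [recStep, consLetter]
    | mul u₁ u₂ h₁ h₂ =>
      intro w s
      rw [map_mul, Module.End.mul_apply]
      obtain ⟨w', s', h⟩ : ∃ w' s', TensorAlgebra.lift (ZMod 3) recStep u₂ (w, s) = (w', s') :=
        ⟨_, _, rfl⟩
      have h' := h₂ w s
      rw [h] at h' ⊢
      rw [h₁, mul_assoc, ← h']
    | add u₁ u₂ h₁ h₂ =>
      intro w s
      rw [map_add, LinearMap.add_apply, Prod.fst_add, h₁, h₂, add_mul]
  simpa [recTriple] using key v 1 (0, 0)

/-- The action is zero on `X^{⊗0}`. -/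
theorem opA_one : opA 1 = 0 := by simp [opA, recTriple]

/-- The action is zero on `X^{⊗0}`. -/
theorem opT_one : opT 1 = 0 := by simp [opT, recTriple]

/-- `a · (y ⊗ v) = ∂ₓ y ⊗ v`. -/
theorem opA_cons (y : Alphabet) (v : Tens) :
    opA (TensorAlgebra.ι (ZMod 3) y * v) = TensorAlgebra.ι (ZMod 3) (dx y) * v := by
  simp [opA, recTriple_cons, recStep, consLetter, recTriple_fst]

/-- `t · (y ⊗ v) = x y ⊗ (a · v) + x² y ⊗ (t · v)`. -/
theorem opT_cons (y : Alphabet) (v : Tens) :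
    opT (TensorAlgebra.ι (ZMod 3) y * v) =
      TensorAlgebra.ι (ZMod 3) (x * y) * opA v + TensorAlgebra.ι (ZMod 3) (x ^ 2 * y) * opT v := by
  simp [opT, opA, recTriple_cons, recStep, consLetter]

/-- The Gupta–Sidki Lie algebra: the Lie algebra generated by `a` and `t`, made faithful on
`T(X)`, i.e. the Lie algebra of operators on `T(X)` generated by the actions of `a` and `t`. -/
def gsLie : LieSubalgebra (ZMod 3) (Module.End (ZMod 3) Tens) :=
  LieSubalgebra.lieSpan (ZMod 3) (Module.End (ZMod 3) Tens) {opA, opT}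

end

end GuptaSidki

/-- Lie polynomials in countably many indeterminates: the free Lie algebra on `ℕ`, realised as the
Lie subalgebra generated by the indeterminates inside the free associative algebra. -/
def LiePolynomials (k : Type*) [CommRing k] : LieSubalgebra k (FreeAlgebra k ℕ) :=
  LieSubalgebra.lieSpan k (FreeAlgebra k ℕ) (Set.range (FreeAlgebra.ι k))

/-- A Lie algebra `L` of elements of an associative algebra `A` (with the commutator bracket) is PI
if some non-zero Lie polynomial vanishes under every substitution of elements of `L`. Since brackets
in `L` are commutators in `A`, the value of a Lie polynomial may be computed in `A`. -/
def LieSubalgebra.IsPI {k A : Type*} [CommRing k] [Ring A] [Algebra k A]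
    (L : LieSubalgebra k A) : Prop :=
  ∃ P ∈ LiePolynomials k, P ≠ 0 ∧
    ∀ f : ℕ → A, (∀ i, f i ∈ L) → FreeAlgebra.lift k f P = 0

/-! For `y ∈ X` and an operator `u` write `y ⊗ u` for the operator `z ⊗ v ↦ yz ⊗ u v`. These
operators multiply like `X ⊗ End T(X)`, and `t = x ⊗ a + x² ⊗ t`. The derived subalgebra `[L, L]` is
spanned from `[a, t]` and `1 ⊗ t` by the maps `u ↦ y ⊗ u`. As cubing is additive up to double
brackets in characteristic three, it follows that `z³ ∈ [L, L]` for all `z ∈ L`.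

Nillity: an operator `1 ⊗ z₀ + x ⊗ z₁ + x² ⊗ z₂` is nilpotent as soon as `z₀` is, since `x` is. For
`z ∈ L` both `z³` and its coordinate `z₀` lie in the ideal `𝔽₃t + [L, L]`, all of whose elements are
of this form. Cubing triples the length of an operator as a polynomial in `a` and `t`, and each
passage to the coordinate `z₀` halves it, as `t` multiplies by at least one `x` and only `a` lowers
the degree in `x`, by one. Two passages thus contract the length by the factor `3/4`.

Identities: `L` contains operators `e₀, e₁, …` acting as the matrix units `E_{k,k+1}` on arbitrarily
long chains of tensors. A non-zero associative polynomial therefore takes a non-zero value on `L`: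
substitute for each letter the sum of the `e_k` over its positions `k` in a shortest monomial. The
polynomials `X₀ⁿ` and `ad(X₀)ⁿ(X₁)` give the unbounded nillity.
-/

namespace GuptaSidki

noncomputable section

/-! ### Derived subalgebras of generated Lie algebras -/

section Derived

variable {R A : Type*} [CommRing R] [LieRing A] [LieAlgebra R A]

theorem lie_mem_of_mem_lieSpan {s : Set A} {N : Submodule R A}
    (hN : ∀ u ∈ s, ∀ w ∈ N, ⁅u, w⁆ ∈ N) {z w : A} (hz : z ∈ LieSubalgebra.lieSpan R A s)
    (hw : w ∈ N) : ⁅z, w⁆ ∈ N := by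
  induction hz using LieSubalgebra.lieSpan_induction generalizing w with
  | mem u hu => exact hN u hu w hw
  | zero => simp
  | add y z _ _ hy hz => rw [add_lie]; exact N.add_mem (hy hw) (hz hw)
  | smul c z _ hz => rw [smul_lie]; exact N.smul_mem c (hz hw)
  | lie y z _ _ hy hz => rw [lie_lie]; exact N.sub_mem (hy (hz hw)) (hz (hy hw))

theorem lie_mem_of_generators_lie_mem {s : Set A} {N : Submodule R A}
    (hN : ∀ u ∈ s, ∀ w ∈ N, ⁅u, w⁆ ∈ N) {v : A} (hv : ∀ u ∈ s, ⁅u, v⁆ ∈ N) {z : A}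
    (hz : z ∈ LieSubalgebra.lieSpan R A s) : ⁅z, v⁆ ∈ N := by
  induction hz using LieSubalgebra.lieSpan_induction with
  | mem u hu => exact hv u hu
  | zero => simp
  | add y z _ _ hy hz => rw [add_lie]; exact N.add_mem hy hz
  | smul c z _ hz => rw [smul_lie]; exact N.smul_mem c hz
  | lie y z hy hz hyv hzv =>
    rw [lie_lie]
    exact N.sub_mem (lie_mem_of_mem_lieSpan hN hy hzv) (lie_mem_of_mem_lieSpan hN hz hyv)

/-- The derived subalgebra `[L, L]` of a Lie subalgebra `L`, as a subspace of the ambient Lie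
algebra. -/
def derivedSubspace (L : LieSubalgebra R A) : Submodule R A :=
  Submodule.span R {u | ∃ z ∈ L, ∃ w ∈ L, ⁅z, w⁆ = u}

theorem lie_mem_derivedSubspace {L : LieSubalgebra R A} {z w : A} (hz : z ∈ L) (hw : w ∈ L) :
    ⁅z, w⁆ ∈ derivedSubspace L :=
  Submodule.subset_span ⟨z, hz, w, hw, rfl⟩

theorem derivedSubspace_le (L : LieSubalgebra R A) : derivedSubspace L ≤ L.toSubmodule :=
  Submodule.span_le.mpr fun _ ⟨_, hz, _, hw, h⟩ => h ▸ L.lie_mem hz hw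

theorem derivedSubspace_lieSpan_le {s : Set A} {N : Submodule R A}
    (hs : ∀ u ∈ s, ∀ v ∈ s, ⁅u, v⁆ ∈ N) (hN : ∀ u ∈ s, ∀ w ∈ N, ⁅u, w⁆ ∈ N) :
    derivedSubspace (LieSubalgebra.lieSpan R A s) ≤ N := by
  have lie_generator_mem {z u : A} (hz : z ∈ LieSubalgebra.lieSpan R A s) (hu : u ∈ s) :
      ⁅u, z⁆ ∈ N := by
    rw [← lie_skew]
    exact N.neg_mem (lie_mem_of_generators_lie_mem hN (fun v hv => hs v hv u hu) hz)
  refine Submodule.span_le.mpr ?_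
  rintro _ ⟨z, hz, w, hw, rfl⟩
  exact lie_mem_of_generators_lie_mem hN (fun u hu => lie_generator_mem hw hu) hz

theorem lieSpan_le_span_sup_derivedSubspace (s : Set A) :
    (LieSubalgebra.lieSpan R A s).toSubmodule ≤
      Submodule.span R s ⊔ derivedSubspace (LieSubalgebra.lieSpan R A s) := by
  intro z hz
  induction hz using LieSubalgebra.lieSpan_induction with
  | mem u hu => exact Submodule.mem_sup_left (Submodule.subset_span hu)
  | zero => exact Submodule.zero_mem _
  | add y z _ _ hy hz => exact Submodule.add_mem _ hy hz
  | smul c z _ hz => exact Submodule.smul_mem _ c hz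
  | lie y z hy hz _ _ => exact Submodule.mem_sup_right (lie_mem_derivedSubspace hy hz)

end Derived

/-! ### Cubes in characteristic three -/

section Cubes

variable {R A : Type*} [CommRing R] [Ring A] [Algebra R A]

theorem add_pow_three (three_eq_zero : (3 : A) = 0) (u w : A) :
    (u + w) ^ 3 = u ^ 3 + w ^ 3 + ⁅u, ⁅u, w⁆⁆ + ⁅w, ⁅w, u⁆⁆ := by
  have expand : (u + w) ^ 3 =
      u ^ 3 + w ^ 3 + ⁅u, ⁅u, w⁆⁆ + ⁅w, ⁅w, u⁆⁆ + 3 * (u * w * u + w * u * w) := by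
    simp only [LieRing.of_associative_ring_bracket]
    noncomm_ring
  rw [expand, three_eq_zero, zero_mul, add_zero]

/-- The elements of `L` whose cube lies in the derived subalgebra of `L`. They form a subspace
because cubing is additive up to double brackets. -/
def cubeSubspace (three_eq_zero : (3 : A) = 0) (L : LieSubalgebra R A) : Submodule R A where
  carrier := {z | z ∈ L ∧ z ^ 3 ∈ derivedSubspace L}
  zero_mem' := ⟨L.zero_mem, by simp⟩
  add_mem' := by
    rintro u w ⟨hu, hu'⟩ ⟨hw, hw'⟩
    refine ⟨L.add_mem hu hw, ?_⟩
    rw [add_pow_three three_eq_zero]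
    exact add_mem (add_mem (add_mem hu' hw') (lie_mem_derivedSubspace hu (L.lie_mem hu hw)))
      (lie_mem_derivedSubspace hw (L.lie_mem hw hu))
  smul_mem' := by
    rintro c u ⟨hu, hu'⟩
    refine ⟨L.smul_mem c hu, ?_⟩
    rw [smul_pow]
    exact Submodule.smul_mem _ _ hu'

end Cubes

/-! ### Operators on a tensor algebra -/

/-- The algebra of linear operators on `T(M)`. -/
abbrev TensorEnd (R M : Type*) [CommRing R] [AddCommGroup M] [Module R M] : Type _ :=
  Module.End R (TensorAlgebra R M)

section TensorAlgebra

open TensorAlgebra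

variable {R M N : Type*} [CommRing R] [AddCommGroup M] [Module R M] [AddCommGroup N] [Module R N]

theorem tensorAlgebra_mem {S : Submodule R (TensorAlgebra R M)} (one_mem : 1 ∈ S)
    (ι_mul_mem : ∀ y v, ι R y * v ∈ S) (v : TensorAlgebra R M) : v ∈ S := by
  have mul_mem (u : TensorAlgebra R M) : ∀ w ∈ S, u * w ∈ S := by
    induction u using TensorAlgebra.induction with
    | algebraMap r => intro w hw; rw [← Algebra.smul_def]; exact S.smul_mem _ hw
    | ι y => intro w _; exact ι_mul_mem y w
    | mul u₁ u₂ h₁ h₂ => intro w hw; rw [mul_assoc]; exact h₁ _ (h₂ _ hw)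
    | add u₁ u₂ h₁ h₂ => intro w hw; rw [add_mul]; exact S.add_mem (h₁ _ hw) (h₂ _ hw)
  simpa using mul_mem v 1 one_mem

theorem tensorAlgebra_hom_ext {f g : TensorAlgebra R M →ₗ[R] N} (one : f 1 = g 1)
    (ι_mul : ∀ y v, f (ι R y * v) = g (ι R y * v)) : f = g :=
  LinearMap.ext fun v => tensorAlgebra_mem (S := LinearMap.eqLocus f g) one ι_mul v

/-- The endomorphism of `T(M) × N` by which the letter `y` sends `(v, s)` to `(y ⊗ v, f y v)`. -/
def consStep (f : M →ₗ[R] TensorAlgebra R M →ₗ[R] N) :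
    M →ₗ[R] Module.End R (TensorAlgebra R M × N) where
  toFun y := ((LinearMap.mulLeft R (ι R y)).prod (f y)).comp (LinearMap.fst _ _ _)
  map_add' y z := by ext <;> simp [add_mul]
  map_smul' c y := by ext <;> simp

theorem lift_consStep_fst (f : M →ₗ[R] TensorAlgebra R M →ₗ[R] N) (u : TensorAlgebra R M)
    (p : TensorAlgebra R M × N) :
    (lift R (consStep f) u p).1 = u * p.1 := by
  induction u using TensorAlgebra.induction generalizing p with
  | algebraMap r => simp [Algebra.smul_def, Module.algebraMap_end_apply]
  | ι y => simp [consStep]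
  | mul u₁ u₂ h₁ h₂ => rw [map_mul, Module.End.mul_apply, h₁, h₂, mul_assoc]
  | add u₁ u₂ h₁ h₂ => rw [map_add, LinearMap.add_apply, Prod.fst_add, h₁, h₂, add_mul]

/-- The linear map that kills `1` and sends `y ⊗ v` to `f y v`. -/
def consRec (f : M →ₗ[R] TensorAlgebra R M →ₗ[R] N) : TensorAlgebra R M →ₗ[R] N :=
  (LinearMap.snd _ _ _).comp
    ((LinearMap.applyₗ (1, 0)).comp (lift R (consStep f)).toLinearMap)

theorem consRec_one (f : M →ₗ[R] TensorAlgebra R M →ₗ[R] N) : consRec f 1 = 0 := by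
  simp [consRec]

theorem consRec_ι_mul (f : M →ₗ[R] TensorAlgebra R M →ₗ[R] N) (y : M) (v : TensorAlgebra R M) :
    consRec f (ι R y * v) = f y v := by
  have head_value : consRec f (ι R y * v) = f y (lift R (consStep f) v (1, 0)).1 := by
    simp [consRec, consStep]
  rw [head_value, lift_consStep_fst, mul_one]

/-- The operator `g ⊗ u` on `T(M)`, which kills `1` and sends `y ⊗ v` to `g y ⊗ u v`. -/
def consMap :
    Module.End R M →ₗ[R] TensorEnd R M →ₗ[R] TensorEnd R M :=
  LinearMap.mk₂ R
    (fun g u => consRec ((LinearMap.mul R (TensorAlgebra R M)).compl₁₂ ((ι R).comp g) u))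
    (fun _ _ _ => tensorAlgebra_hom_ext (by simp [consRec_one])
      fun _ _ => by simp [consRec_ι_mul])
    (fun _ _ _ => tensorAlgebra_hom_ext (by simp [consRec_one]) fun _ _ => by simp [consRec_ι_mul])
    (fun _ _ _ => tensorAlgebra_hom_ext (by simp [consRec_one])
      fun _ _ => by simp [consRec_ι_mul, mul_add])
    (fun _ _ _ => tensorAlgebra_hom_ext (by simp [consRec_one]) fun _ _ => by simp [consRec_ι_mul])

variable (g h : Module.End R M) (u w : TensorEnd R M)

@[simp]
theorem consMap_one : consMap g u 1 = 0 :=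
  consRec_one _

@[simp]
theorem consMap_ι_mul (y : M) (v : TensorAlgebra R M) :
    consMap g u (ι R y * v) = ι R (g y) * u v :=
  consRec_ι_mul _ y v

theorem consMap_mul : consMap g u * consMap h w = consMap (g * h) (u * w) :=
  tensorAlgebra_hom_ext (by simp) fun y v => by simp

/-- The operator that kills `1` and sends `y ⊗ v` to `φ y • v`. -/
def contractHead : Module.Dual R M →ₗ[R] TensorEnd R M where
  toFun φ := consRec (φ.smulRight LinearMap.id)
  map_add' φ ψ := tensorAlgebra_hom_ext (by simp [consRec_one])
    fun y v => by simp [consRec_ι_mul, add_smul]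
  map_smul' c φ := tensorAlgebra_hom_ext (by simp [consRec_one])
    fun y v => by simp [consRec_ι_mul, mul_smul]

variable (φ : Module.Dual R M)

@[simp]
theorem contractHead_one : contractHead φ 1 = 0 :=
  consRec_one _

@[simp]
theorem contractHead_ι_mul (y : M) (v : TensorAlgebra R M) :
    contractHead φ (ι R y * v) = φ y • v :=
  consRec_ι_mul _ y v

theorem contractHead_mul_consMap :
    contractHead φ * consMap g u = u * contractHead (φ.comp g) :=
  tensorAlgebra_hom_ext (by simp) fun y v => by simp

end TensorAlgebra

section LetterMul

variable {R A : Type*} [CommRing R] [CommRing A] [Algebra R A]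

/-- The operator `y ⊗ u` on `T(A)`, for a letter `y` of a commutative algebra `A` acting by
multiplication. -/
def letterMul :
    A →ₗ[R] TensorEnd R A →ₗ[R] TensorEnd R A :=
  consMap.comp (LinearMap.mul R A)

variable (y z : A) (u w : TensorEnd R A)

@[simp]
theorem letterMul_one : letterMul y u 1 = 0 :=
  consMap_one _ u

@[simp]
theorem letterMul_ι_mul (v : TensorAlgebra R A) :
    letterMul y u (TensorAlgebra.ι R z * v) = TensorAlgebra.ι R (y * z) * u v :=
  consMap_ι_mul _ u z v

theorem neg_letterMul : letterMul (-y) u = -letterMul y u :=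
  letterMul.map_neg₂ y u

theorem zero_letterMul : letterMul (0 : A) u = 0 :=
  letterMul.map_zero₂ u

theorem letterMul_mul : letterMul y u * letterMul z w = letterMul (y * z) (u * w) :=
  tensorAlgebra_hom_ext (by simp) fun s v => by simp [mul_assoc]

theorem letterMul_pow_succ (n : ℕ) :
    letterMul y u ^ (n + 1) = letterMul (y ^ (n + 1)) (u ^ (n + 1)) := by
  induction n with
  | zero => simp
  | succ n ih => rw [pow_succ, ih, letterMul_mul, ← pow_succ, ← pow_succ]

theorem letterMul_lie : ⁅letterMul y u, letterMul z w⁆ = letterMul (y * z) ⁅u, w⁆ := by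
  simp only [LieRing.of_associative_ring_bracket, letterMul_mul, mul_comm z y, map_sub]

theorem consMap_lie_letterMul (D : Derivation R A A) :
    ⁅consMap D.toLinearMap 1, letterMul y u⁆ = letterMul (D y) u :=
  tensorAlgebra_hom_ext (by simp [LieRing.of_associative_ring_bracket]) fun z v => by
    simp [LieRing.of_associative_ring_bracket, add_mul, mul_comm z]

end LetterMul

local notation:74 y:75 "⊠" u:74 => letterMul y u

/-! ### The Gupta–Sidki operators -/

/-- A model of the Gupta–Sidki operators: the truncated polynomial algebra `A = R[x]/(x³)` over a
ring of characteristic three, its derivation `d = d/dx`, and operators `a = d ⊗ 1` and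
`t = x ⊗ a + x² ⊗ t` on the tensor algebra of `A`. -/
structure Model (R A : Type*) [CommRing R] [CommRing A] [Algebra R A] where
  three_eq_zero : (3 : R) = 0
  x : A
  x_pow_three : x ^ 3 = 0
  basis : Module.Basis (Fin 3) R A
  basis_apply (i : Fin 3) : basis i = x ^ (i : ℕ)
  d : Derivation R A A
  d_x : d x = 1
  a : TensorEnd R A
  t : TensorEnd R A
  a_eq : a = consMap d.toLinearMap 1
  t_eq : t = x ⊠ a + x ^ 2 ⊠ t

namespace Model

variable {R A N : Type*} [CommRing R] [CommRing A] [Algebra R A] [AddCommGroup N] [Module R N]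
  (S : Model R A)

include S in
theorem three_smul (v : N) : (3 : R) • v = 0 := by
  rw [S.three_eq_zero, zero_smul]

theorem d_x_sq : S.d (S.x ^ 2) = -S.x := by
  rw [Derivation.leibniz_pow, S.d_x, smul_eq_mul, mul_one, pow_one, eq_neg_iff_add_eq_zero,
    ← succ_nsmul, ← Nat.cast_smul_eq_nsmul R]
  exact S.three_smul S.x

theorem mem_of_pow_mem {W : Submodule R A} (hW : ∀ i < 3, S.x ^ i ∈ W) (y : A) : y ∈ W := by
  have span_le : Submodule.span R (Set.range S.basis) ≤ W :=
    Submodule.span_le.mpr (Set.range_subset_iff.mpr fun i => S.basis_apply i ▸ hW i i.isLt)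
  exact span_le (S.basis.mem_span y)

theorem hom_ext {f g : A →ₗ[R] N} (h : ∀ i < 3, f (S.x ^ i) = g (S.x ^ i)) : f = g :=
  LinearMap.ext fun y => S.mem_of_pow_mem (W := LinearMap.eqLocus f g) h y

/-- The functional extracting the coefficient of `x ^ p`. It is zero for `p ≥ 3`. -/
def coef (p : ℕ) : Module.Dual R A :=
  if hp : p < 3 then S.basis.coord ⟨p, hp⟩ else 0

theorem coef_of_three_le {p : ℕ} (hp : 3 ≤ p) : S.coef p = 0 :=
  dif_neg hp.not_gt

theorem coef_x_pow (p : ℕ) {i : ℕ} (hi : i < 3) :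
    S.coef p (S.x ^ i) = if p = i then 1 else 0 := by
  have x_pow_eq : S.x ^ i = S.basis ⟨i, hi⟩ := (S.basis_apply ⟨i, hi⟩).symm
  rcases lt_or_ge p 3 with hp | hp
  · rw [coef, dif_pos hp, x_pow_eq, Module.Basis.coord_apply, Module.Basis.repr_self,
      Finsupp.single_apply]
    simp only [Fin.mk.injEq, eq_comm]
  · rw [S.coef_of_three_le hp, if_neg (by omega), LinearMap.zero_apply]

theorem coef_comp_x_pow_mul {p i : ℕ} (hp : p < 3) :
    (S.coef p).comp (LinearMap.mul R A (S.x ^ i)) = if i ≤ p then S.coef (p - i) else 0 := by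
  refine S.hom_ext fun j hj => ?_
  have x_pow_add : S.coef p (S.x ^ (i + j)) = if p = i + j then 1 else 0 := by
    rcases lt_or_ge (i + j) 3 with hij | hij
    · exact S.coef_x_pow p hij
    · rw [pow_eq_zero_of_le hij S.x_pow_three, map_zero, if_neg (by omega)]
  rw [LinearMap.comp_apply, LinearMap.mul_apply', ← pow_add, x_pow_add]
  split_ifs with h1 h2 h2
  · rw [S.coef_x_pow _ hj, if_pos (by omega)]
  · omega
  · rw [S.coef_x_pow _ hj, if_neg (by omega)]
  · rfl

theorem coef_comp_d (p : ℕ) : (S.coef p).comp S.d.toLinearMap = (p + 1 : R) • S.coef (p + 1) := by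
  refine S.hom_ext fun i hi => ?_
  change S.coef p (S.d (S.x ^ i)) = (p + 1 : R) * S.coef (p + 1) (S.x ^ i)
  rw [S.coef_x_pow _ hi, Derivation.leibniz_pow, S.d_x, smul_eq_mul, mul_one, map_nsmul,
    S.coef_x_pow _ (by omega)]
  rcases i with - | i
  · simp
  · by_cases hp : p = i <;> simp [hp]

theorem d_d_d (y : A) : S.d (S.d (S.d y)) = 0 := by
  suffices h : S.d.toLinearMap ∘ₗ S.d.toLinearMap ∘ₗ S.d.toLinearMap = 0 from
    LinearMap.congr_fun h y
  refine S.hom_ext fun i hi => ?_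
  change S.d (S.d (S.d (S.x ^ i))) = 0
  interval_cases i
  · simp
  · simp [S.d_x]
  · rw [S.d_x_sq, map_neg, S.d_x, map_neg, S.d.map_one_eq_zero, neg_zero]

/-! ### The derived subalgebra -/

theorem a_lie_letterMul (y : A) (u : TensorEnd R A) :
    ⁅S.a, y ⊠ u⁆ = S.d y ⊠ u := by
  rw [S.a_eq, consMap_lie_letterMul]

theorem t_lie_letterMul (y : A) (u : TensorEnd R A) :
    ⁅S.t, y ⊠ u⁆ = (S.x * y) ⊠ ⁅S.a, u⁆ + (S.x ^ 2 * y) ⊠ ⁅S.t, u⁆ := by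
  conv_lhs => rw [S.t_eq]
  rw [add_lie, letterMul_lie, letterMul_lie]

theorem a_lie_one_letterMul (u : TensorEnd R A) : ⁅S.a, 1 ⊠ u⁆ = 0 := by
  rw [a_lie_letterMul, S.d.map_one_eq_zero, zero_letterMul]

theorem t_lie_one_letterMul (u : TensorEnd R A) :
    ⁅S.t, 1 ⊠ u⁆ = S.x ⊠ ⁅S.a, u⁆ + S.x ^ 2 ⊠ ⁅S.t, u⁆ := by
  rw [t_lie_letterMul, mul_one, mul_one]

theorem t_lie_x_letterMul (u : TensorEnd R A) :
    ⁅S.t, S.x ⊠ u⁆ = S.x ^ 2 ⊠ ⁅S.a, u⁆ := by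
  rw [t_lie_letterMul, ← pow_two, ← pow_succ, S.x_pow_three, zero_letterMul, add_zero]

theorem a_lie_t : ⁅S.a, S.t⁆ = 1 ⊠ S.a - S.x ⊠ S.t := by
  conv_lhs => rw [S.t_eq]
  rw [lie_add, a_lie_letterMul, a_lie_letterMul, S.d_x, S.d_x_sq, neg_letterMul, ← sub_eq_add_neg]

theorem a_lie_a_lie_t : ⁅S.a, ⁅S.a, S.t⁆⁆ = -(1 ⊠ S.t) := by
  rw [a_lie_t, lie_sub, a_lie_one_letterMul, a_lie_letterMul, S.d_x, zero_sub]

theorem t_lie_a_lie_t : ⁅S.t, ⁅S.a, S.t⁆⁆ = S.x ^ 2 ⊠ ⁅S.a, S.t⁆ :=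
  calc ⁅S.t, ⁅S.a, S.t⁆⁆ = ⁅S.t, 1 ⊠ S.a⁆ - ⁅S.t, S.x ⊠ S.t⁆ := by rw [a_lie_t, lie_sub]
    _ = -(S.x ^ 2 ⊠ ⁅S.a, S.t⁆) - S.x ^ 2 ⊠ ⁅S.a, S.t⁆ := by
        rw [t_lie_one_letterMul, t_lie_x_letterMul, lie_self, map_zero, zero_add,
          ← lie_skew S.t S.a, map_neg]
    _ = S.x ^ 2 ⊠ ⁅S.a, S.t⁆ - (3 : R) • S.x ^ 2 ⊠ ⁅S.a, S.t⁆ := by module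
    _ = S.x ^ 2 ⊠ ⁅S.a, S.t⁆ := by rw [S.three_smul, sub_zero]

/-- The Lie algebra generated by `a` and `t`. -/
def lieAlgebra : LieSubalgebra R (TensorEnd R A) :=
  LieSubalgebra.lieSpan R (TensorEnd R A) {S.a, S.t}

/-- The derived subalgebra of the Lie algebra generated by `a` and `t`, as a space of operators. -/
def derived : Submodule R (TensorEnd R A) :=
  derivedSubspace S.lieAlgebra

variable {u : TensorEnd R A}

theorem a_mem : S.a ∈ S.lieAlgebra :=
  LieSubalgebra.subset_lieSpan (Set.mem_insert _ _)

theorem t_mem : S.t ∈ S.lieAlgebra :=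
  LieSubalgebra.subset_lieSpan (Set.mem_insert_of_mem _ rfl)

theorem mem_of_mem_derived (hu : u ∈ S.derived) : u ∈ S.lieAlgebra :=
  derivedSubspace_le _ hu

theorem lie_mem_derived {z : TensorEnd R A} (hz : z ∈ S.lieAlgebra)
    (hu : u ∈ S.lieAlgebra) : ⁅z, u⁆ ∈ S.derived :=
  lie_mem_derivedSubspace hz hu

theorem lie_mem_derived_of_mem_derived {z : TensorEnd R A}
    (hz : z ∈ S.lieAlgebra) (hu : u ∈ S.derived) : ⁅z, u⁆ ∈ S.derived :=
  S.lie_mem_derived hz (S.mem_of_mem_derived hu)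

theorem derived_le {W : Submodule R (TensorEnd R A)}
    (commutator_mem : ⁅S.a, S.t⁆ ∈ W) (a_lie_mem : ∀ u ∈ W, ⁅S.a, u⁆ ∈ W)
    (t_lie_mem : ∀ u ∈ W, ⁅S.t, u⁆ ∈ W) : S.derived ≤ W := by
  refine derivedSubspace_lieSpan_le ?_ ?_
  · rintro _ (rfl | rfl) _ (rfl | rfl)
    · simp
    · exact commutator_mem
    · rw [← lie_skew]
      exact W.neg_mem commutator_mem
    · simp
  · rintro _ (rfl | rfl)
    · exact a_lie_mem
    · exact t_lie_mem

theorem lieAlgebra_le_span_sup_derived :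
    S.lieAlgebra.toSubmodule ≤ Submodule.span R {S.a, S.t} ⊔ S.derived :=
  lieSpan_le_span_sup_derivedSubspace _

theorem commutator_mem_derived : ⁅S.a, S.t⁆ ∈ S.derived :=
  S.lie_mem_derived S.a_mem S.t_mem

theorem one_letterMul_t_mem_derived : 1 ⊠ S.t ∈ S.derived := by
  have h := S.lie_mem_derived_of_mem_derived S.a_mem S.commutator_mem_derived
  rwa [a_lie_a_lie_t, Submodule.neg_mem_iff] at h

theorem letterMul_mem_derived_of_x_sq (hu : letterMul (S.x ^ 2) u ∈ S.derived) (y : A) :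
    y ⊠ u ∈ S.derived := by
  have x_mem : S.x ⊠ u ∈ S.derived := by
    have h := S.lie_mem_derived_of_mem_derived S.a_mem hu
    rwa [a_lie_letterMul, S.d_x_sq, neg_letterMul, Submodule.neg_mem_iff] at h
  have one_mem : 1 ⊠ u ∈ S.derived := by
    have h := S.lie_mem_derived_of_mem_derived S.a_mem x_mem
    rwa [a_lie_letterMul, S.d_x] at h
  refine S.mem_of_pow_mem (W := S.derived.comap (letterMul.flip u)) (fun i hi => ?_) y
  interval_cases i
  · rwa [pow_zero]
  · rwa [pow_one]
  · exact hu

theorem letterMul_mem_derived (y : A) (hu : u ∈ S.derived) : y ⊠ u ∈ S.derived := by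
  refine S.letterMul_mem_derived_of_x_sq ?_ y
  suffices h : S.derived ≤ S.derived.comap (letterMul (S.x ^ 2)) from h hu
  refine S.derived_le ?_ (fun u hu => ?_) fun u hu => ?_
  · have h := S.lie_mem_derived_of_mem_derived S.t_mem S.commutator_mem_derived
    rwa [t_lie_a_lie_t] at h
  · have h := S.lie_mem_derived_of_mem_derived S.t_mem (S.letterMul_mem_derived_of_x_sq hu S.x)
    rwa [t_lie_x_letterMul] at h
  · have h := S.lie_mem_derived_of_mem_derived
      (S.mem_of_mem_derived S.one_letterMul_t_mem_derived) hu
    rwa [letterMul_lie, one_mul] at h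

/-- The operators generated from `[a, t]` and `1 ⊗ t` by linear combinations and by `u ↦ y ⊗ u`:
the recursive description of the derived subalgebra. -/
inductive Layered : TensorEnd R A → Prop
  | commutator : Layered ⁅S.a, S.t⁆
  | one_letterMul_t : Layered (1 ⊠ S.t)
  | zero : Layered 0
  | add {u w} : Layered u → Layered w → Layered (u + w)
  | smul (c : R) {u} : Layered u → Layered (c • u)
  | letterMul (y : A) {u} : Layered u → Layered (y ⊠ u)

variable {S}

theorem Layered.mem_derived (hu : S.Layered u) : u ∈ S.derived := by
  induction hu with
  | commutator => exact S.commutator_mem_derived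
  | one_letterMul_t => exact S.one_letterMul_t_mem_derived
  | zero => exact Submodule.zero_mem _
  | add _ _ hu hw => exact Submodule.add_mem _ hu hw
  | smul c _ hu => exact Submodule.smul_mem _ c hu
  | letterMul y _ hu => exact S.letterMul_mem_derived y hu

theorem Layered.a_lie (hu : S.Layered u) : S.Layered ⁅S.a, u⁆ := by
  induction hu with
  | commutator => rw [a_lie_a_lie_t, ← neg_one_smul R]; exact one_letterMul_t.smul _
  | one_letterMul_t => rw [a_lie_one_letterMul]; exact zero
  | zero => rw [lie_zero]; exact zero
  | add _ _ hu hw => rw [lie_add]; exact hu.add hw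
  | smul c _ hu => rw [LieAlgebra.lie_smul]; exact hu.smul c
  | letterMul y hu => rw [a_lie_letterMul]; exact hu.letterMul _

theorem Layered.t_lie (hu : S.Layered u) : S.Layered ⁅S.t, u⁆ := by
  induction hu with
  | commutator => rw [t_lie_a_lie_t]; exact commutator.letterMul _
  | one_letterMul_t =>
    rw [t_lie_one_letterMul, lie_self, map_zero, add_zero]
    exact commutator.letterMul _
  | zero => rw [lie_zero]; exact zero
  | add _ _ hu hw => rw [lie_add]; exact hu.add hw
  | smul c _ hu => rw [LieAlgebra.lie_smul]; exact hu.smul c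
  | letterMul y hu htu =>
    rw [t_lie_letterMul]
    exact (hu.a_lie.letterMul _).add (htu.letterMul _)

theorem layered_of_mem_derived (hu : u ∈ S.derived) : S.Layered u := by
  let W : Submodule R (TensorEnd R A) :=
    { carrier := {u | S.Layered u}
      zero_mem' := .zero
      add_mem' := .add
      smul_mem' := fun c _ => .smul c }
  exact S.derived_le (W := W) .commutator (fun _ => Layered.a_lie) (fun _ => Layered.t_lie) hu

/-! ### Cubes -/

variable (S)

include S in
theorem three_eq_zero_end : (3 : TensorEnd R A) = 0 := by
  rw [← S.three_smul (1 : TensorEnd R A), ofNat_smul_eq_nsmul, nsmul_one,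
    Nat.cast_ofNat]

theorem a_pow_three : S.a ^ 3 = 0 := by
  have d_pow_three : (S.d.toLinearMap : Module.End R A) ^ 3 = 0 := LinearMap.ext S.d_d_d
  calc S.a ^ 3 = consMap (S.d.toLinearMap ^ 3) 1 := by
        simp only [a_eq, pow_three, consMap_mul, mul_one]
    _ = 0 := by rw [d_pow_three, map_zero, LinearMap.zero_apply]

theorem t_pow_three : S.t ^ 3 = 0 := by
  have x_pow_eq_zero {k : ℕ} (hk : 3 ≤ k) : S.x ^ k = 0 := pow_eq_zero_of_le hk S.x_pow_three
  rw [t_eq, add_pow_three S.three_eq_zero_end]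
  simp only [letterMul_lie, letterMul_pow_succ, ← pow_mul, ← pow_add, ← pow_succ, ← pow_succ']
  simp [x_pow_eq_zero]

theorem commutator_pow_three_mem_derived : ⁅S.a, S.t⁆ ^ 3 ∈ S.derived := by
  have expand : ⁅S.a, S.t⁆ ^ 3 =
      -(S.x ⊠ ⁅S.a, ⁅S.a, S.t⁆⁆) + S.x ^ 2 ⊠ ⁅S.t, ⁅S.t, S.a⁆⁆ := by
    conv_lhs => rw [a_lie_t, sub_eq_add_neg, add_pow_three S.three_eq_zero_end]
    simp only [Odd.neg_pow (by decide : Odd 3), letterMul_pow_succ _ _ 2, Nat.reduceAdd,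
      a_pow_three, t_pow_three, map_zero, neg_zero, zero_add, lie_neg, neg_lie, neg_neg,
      letterMul_lie, one_mul, mul_one, ← pow_two]
  rw [expand]
  refine add_mem (neg_mem ?_) ?_
  · exact S.letterMul_mem_derived _
      (S.lie_mem_derived_of_mem_derived S.a_mem S.commutator_mem_derived)
  · exact S.letterMul_mem_derived _
      (S.lie_mem_derived_of_mem_derived S.t_mem (S.lie_mem_derived S.t_mem S.a_mem))

theorem Layered.pow_three_mem_derived (hu : S.Layered u) : u ^ 3 ∈ S.derived := by
  suffices h : u ∈ cubeSubspace S.three_eq_zero_end S.lieAlgebra from h.2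
  induction hu with
  | commutator => exact ⟨S.lieAlgebra.lie_mem S.a_mem S.t_mem, S.commutator_pow_three_mem_derived⟩
  | one_letterMul_t =>
    refine ⟨S.mem_of_mem_derived S.one_letterMul_t_mem_derived, ?_⟩
    rw [letterMul_pow_succ, t_pow_three, map_zero]
    exact Submodule.zero_mem _
  | zero => exact Submodule.zero_mem _
  | add _ _ hu hw => exact Submodule.add_mem _ hu hw
  | smul c _ hu => exact Submodule.smul_mem _ c hu
  | letterMul y hu hu3 =>
    refine ⟨S.mem_of_mem_derived (S.letterMul_mem_derived y hu.mem_derived), ?_⟩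
    rw [letterMul_pow_succ]
    exact S.letterMul_mem_derived _ hu3.2

theorem pow_three_mem_derived {z : TensorEnd R A} (hz : z ∈ S.lieAlgebra) :
    z ^ 3 ∈ S.derived := by
  suffices h : Submodule.span R {S.a, S.t} ⊔ S.derived ≤
      cubeSubspace S.three_eq_zero_end S.lieAlgebra from
    (h (S.lieAlgebra_le_span_sup_derived hz)).2
  refine sup_le (Submodule.span_le.mpr ?_) fun u hu =>
    ⟨S.mem_of_mem_derived hu, (layered_of_mem_derived hu).pow_three_mem_derived⟩
  rintro _ (rfl | rfl)
  · exact ⟨S.a_mem, S.a_pow_three ▸ Submodule.zero_mem _⟩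
  · exact ⟨S.t_mem, S.t_pow_three ▸ Submodule.zero_mem _⟩

end Model

/-! ### Nilpotency -/

namespace Model

variable {R A : Type*} [CommRing R] [CommRing A] [Algebra R A] (S : Model R A)

/-- The ideal `Rt + [L, L]` of the Lie algebra `L` generated by `a` and `t`. -/
def tIdeal : Submodule R (TensorEnd R A) :=
  Submodule.span R {S.t} ⊔ S.derived

theorem tIdeal_le : S.tIdeal ≤ S.lieAlgebra.toSubmodule :=
  sup_le (Submodule.span_le.mpr (Set.singleton_subset_iff.mpr S.t_mem))
    fun _ => S.mem_of_mem_derived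

theorem t_mem_tIdeal : S.t ∈ S.tIdeal :=
  Submodule.mem_sup_left (Submodule.mem_span_singleton_self _)

theorem derived_le_tIdeal : S.derived ≤ S.tIdeal :=
  le_sup_right

/-- The operator `1 ⊗ z₀ + x ⊗ z₁ + x² ⊗ z₂` with coordinates `(z₀, z₁, z₂)`. -/
def ofCoord : TensorEnd R A × TensorEnd R A × TensorEnd R A →ₗ[R] TensorEnd R A :=
  (letterMul 1).coprod ((letterMul S.x).coprod (letterMul (S.x ^ 2)))

variable (z₀ z₁ z₂ w₀ w₁ w₂ : TensorEnd R A)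

theorem ofCoord_apply :
    S.ofCoord (z₀, z₁, z₂) = 1 ⊠ z₀ + S.x ⊠ z₁ + S.x ^ 2 ⊠ z₂ := by
  simp [ofCoord, add_assoc]

theorem ofCoord_mul : S.ofCoord (z₀, z₁, z₂) * S.ofCoord (w₀, w₁, w₂) =
    S.ofCoord (z₀ * w₀, z₀ * w₁ + z₁ * w₀, z₀ * w₂ + z₁ * w₁ + z₂ * w₀) := by
  have x_mul_x_sq : S.x * S.x ^ 2 = 0 := by rw [← pow_succ', S.x_pow_three]
  have x_sq_mul_x_sq : S.x ^ 2 * S.x ^ 2 = 0 := by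
    rw [← pow_add, pow_eq_zero_of_le (by decide) S.x_pow_three]
  simp only [ofCoord_apply, mul_add, add_mul, letterMul_mul, one_mul, mul_one, ← pow_two S.x,
    x_mul_x_sq, mul_comm (S.x ^ 2) S.x, x_sq_mul_x_sq, zero_letterMul, map_add]
  abel

theorem a_lie_ofCoord : ⁅S.a, S.ofCoord (z₀, z₁, z₂)⁆ = S.ofCoord (z₁, -z₂, 0) := by
  rw [ofCoord_apply, ofCoord_apply, lie_add, lie_add, a_lie_one_letterMul, a_lie_letterMul,
    a_lie_letterMul, S.d_x, S.d_x_sq, neg_letterMul, map_neg, map_zero, zero_add, add_zero]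

theorem t_lie_ofCoord :
    ⁅S.t, S.ofCoord (z₀, z₁, z₂)⁆ = S.ofCoord (0, ⁅S.a, z₀⁆, ⁅S.t, z₀⁆ + ⁅S.a, z₁⁆) := by
  have t_lie_x_sq : ⁅S.t, S.x ^ 2 ⊠ z₂⁆ = 0 := by
    rw [t_lie_letterMul, ← pow_succ', ← pow_add, pow_eq_zero_of_le (by decide) S.x_pow_three,
      pow_eq_zero_of_le (by decide) S.x_pow_three, zero_letterMul, zero_letterMul, add_zero]
  simp only [ofCoord_apply, lie_add, t_lie_one_letterMul, t_lie_x_letterMul, t_lie_x_sq, map_add,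
    map_zero, zero_add, add_zero, add_assoc]

theorem t_eq_ofCoord : S.t = S.ofCoord (0, S.a, S.t) := by
  conv_lhs => rw [S.t_eq]
  simp only [ofCoord_apply, map_zero, zero_add]

theorem commutator_eq_ofCoord : ⁅S.a, S.t⁆ = S.ofCoord (S.a, -S.t, 0) := by
  conv_lhs => rw [t_eq_ofCoord, a_lie_ofCoord]

theorem exists_ofCoord_pow_succ (n : ℕ) :
    ∃ u w, S.ofCoord (z₀, z₁, z₂) ^ (n + 1) = S.ofCoord (z₀ ^ (n + 1), u, w) := by
  induction n with
  | zero => exact ⟨z₁, z₂, by simp only [zero_add, pow_one]⟩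
  | succ n ih =>
    obtain ⟨u, w, h⟩ := ih
    exact ⟨_, _, by rw [pow_succ, h, ofCoord_mul, ← pow_succ]⟩

variable {z₀} in
theorem isNilpotent_ofCoord (hz₀ : IsNilpotent z₀) : IsNilpotent (S.ofCoord (z₀, z₁, z₂)) := by
  obtain ⟨n, hn⟩ := hz₀
  obtain ⟨u, w, h⟩ := S.exists_ofCoord_pow_succ z₀ z₁ z₂ n
  rw [pow_succ z₀, hn, zero_mul] at h
  refine ⟨(n + 1) * 3, ?_⟩
  rw [pow_mul, h, pow_three, ofCoord_mul, ofCoord_mul]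
  simp only [zero_mul, mul_zero, add_zero]
  exact map_zero _

/-- The operators `1 ⊗ z₀ + x ⊗ z₁ + x² ⊗ z₂` with `z₀, z₁ ∈ L` and `z₂ ∈ Rt + [L, L]`. -/
def coordSubspace : Submodule R (TensorEnd R A) :=
  (S.lieAlgebra.toSubmodule.prod (S.lieAlgebra.toSubmodule.prod S.tIdeal)).map S.ofCoord

variable {S z₀ z₁ z₂} in
theorem ofCoord_mem_coordSubspace (h₀ : z₀ ∈ S.lieAlgebra) (h₁ : z₁ ∈ S.lieAlgebra)
    (h₂ : z₂ ∈ S.tIdeal) : S.ofCoord (z₀, z₁, z₂) ∈ S.coordSubspace :=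
  Submodule.mem_map_of_mem ⟨h₀, h₁, h₂⟩

theorem tIdeal_le_coordSubspace : S.tIdeal ≤ S.coordSubspace := by
  refine sup_le (Submodule.span_le.mpr (Set.singleton_subset_iff.mpr ?_)) (S.derived_le ?_ ?_ ?_)
  · rw [SetLike.mem_coe, t_eq_ofCoord]
    exact ofCoord_mem_coordSubspace (zero_mem _) S.a_mem S.t_mem_tIdeal
  · rw [commutator_eq_ofCoord]
    exact ofCoord_mem_coordSubspace S.a_mem (neg_mem S.t_mem) (zero_mem _)
  · rintro _ ⟨⟨z₀, z₁, z₂⟩, ⟨-, h₁, h₂⟩, rfl⟩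
    rw [a_lie_ofCoord]
    exact ofCoord_mem_coordSubspace h₁ (neg_mem (S.tIdeal_le h₂)) (zero_mem _)
  · rintro _ ⟨⟨z₀, z₁, z₂⟩, ⟨h₀, h₁, -⟩, rfl⟩
    rw [t_lie_ofCoord]
    exact ofCoord_mem_coordSubspace (zero_mem _) (S.lieAlgebra.lie_mem S.a_mem h₀)
      (add_mem (S.derived_le_tIdeal (S.lie_mem_derived S.t_mem h₀))
        (S.derived_le_tIdeal (S.lie_mem_derived S.a_mem h₁)))

theorem lieAlgebra_le_span_sup_coordSubspace :
    S.lieAlgebra.toSubmodule ≤ Submodule.span R {S.a} ⊔ S.coordSubspace := by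
  calc S.lieAlgebra.toSubmodule ≤ Submodule.span R {S.a, S.t} ⊔ S.derived :=
        S.lieAlgebra_le_span_sup_derived
    _ = Submodule.span R {S.a} ⊔ S.tIdeal := by rw [Submodule.span_insert, sup_assoc, tIdeal]
    _ ≤ Submodule.span R {S.a} ⊔ S.coordSubspace := sup_le_sup_left S.tIdeal_le_coordSubspace _

/-- The operator `v ↦ φ_p (z (1 ⊗ v))`, where `φ_p` contracts the first letter with the coefficient
of `x ^ p`. It extracts the coordinates of `ofCoord`. -/
def coord (p : ℕ) : TensorEnd R A →ₗ[R] TensorEnd R A :=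
  (LinearMap.mulLeft R (contractHead (S.coef p))).comp
    (LinearMap.mulRight R (LinearMap.mulLeft R (TensorAlgebra.ι R 1)))

theorem coord_apply (p : ℕ) (z : TensorEnd R A) : S.coord p z =
    contractHead (S.coef p) * (z * LinearMap.mulLeft R (TensorAlgebra.ι R 1)) :=
  rfl

theorem coord_one (p : ℕ) : S.coord p 1 = S.coef p 1 • 1 :=
  LinearMap.ext fun v => by simp [coord_apply]

theorem coord_letterMul (p : ℕ) (y : A) (u : TensorEnd R A) :
    S.coord p (y ⊠ u) = S.coef p y • u :=
  LinearMap.ext fun v => by simp [coord_apply]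

theorem coord_zero_ofCoord : S.coord 0 (S.ofCoord (z₀, z₁, z₂)) = z₀ := by
  have coef_one := S.coef_x_pow 0 (i := 0) (by decide)
  have coef_x := S.coef_x_pow 0 (i := 1) (by decide)
  have coef_x_sq := S.coef_x_pow 0 (i := 2) (by decide)
  rw [pow_zero] at coef_one
  rw [pow_one] at coef_x
  simp [ofCoord_apply, coord_letterMul, coef_one, coef_x, coef_x_sq]

theorem coord_zero_ofCoord_pow_three : S.coord 0 (S.ofCoord (z₀, z₁, z₂) ^ 3) = z₀ ^ 3 := by
  obtain ⟨u, w, h⟩ := S.exists_ofCoord_pow_succ z₀ z₁ z₂ 2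
  rw [h, coord_zero_ofCoord]

theorem coord_zero_ofCoord_lie_ofCoord :
    S.coord 0 ⁅S.ofCoord (z₀, z₁, z₂), S.ofCoord (w₀, w₁, w₂)⁆ = ⁅z₀, w₀⁆ := by
  simp only [LieRing.of_associative_ring_bracket, map_sub, ofCoord_mul, coord_zero_ofCoord]

theorem coord_zero_add_pow_three (c : R) :
    S.coord 0 ((c • S.a + S.ofCoord (z₀, z₁, z₂)) ^ 3) = z₀ ^ 3 - c ^ 2 • z₂ - c • ⁅z₀, z₁⁆ := by
  rw [add_pow_three S.three_eq_zero_end, smul_pow, a_pow_three, smul_zero, zero_add,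
    ← lie_skew _ (c • S.a)]
  simp only [smul_lie, LieAlgebra.lie_smul, lie_neg, a_lie_ofCoord, map_add, map_neg, map_smul,
    coord_zero_ofCoord_pow_three, coord_zero_ofCoord_lie_ofCoord, coord_zero_ofCoord]
  module

theorem coord_zero_pow_three_mem_tIdeal {z : TensorEnd R A} (hz : z ∈ S.lieAlgebra) :
    S.coord 0 (z ^ 3) ∈ S.tIdeal := by
  obtain ⟨_, ha, _, ⟨⟨z₀, z₁, z₂⟩, ⟨h₀, h₁, h₂⟩, rfl⟩, rfl⟩ :=
    Submodule.mem_sup.mp (S.lieAlgebra_le_span_sup_coordSubspace hz)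
  obtain ⟨c, rfl⟩ := Submodule.mem_span_singleton.mp ha
  rw [coord_zero_add_pow_three]
  exact sub_mem (sub_mem (S.derived_le_tIdeal (S.pow_three_mem_derived h₀))
    (Submodule.smul_mem _ _ h₂)) (Submodule.smul_mem _ _
      (S.derived_le_tIdeal (S.lie_mem_derived h₀ h₁)))

/-- The span of the products of at most `n` factors `a` and `t`. -/
def wordSpan (n : ℕ) : Submodule R (TensorEnd R A) :=
  Submodule.span R {1, S.a, S.t} ^ n

theorem wordSpan_mono : Monotone S.wordSpan := by
  refine monotone_nat_of_le_succ fun n => ?_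
  rw [wordSpan, wordSpan, pow_succ]
  exact le_mul_of_one_le_right' (Submodule.one_le.mpr (Submodule.subset_span (by simp)))

theorem one_mem_wordSpan (n : ℕ) : 1 ∈ S.wordSpan n :=
  S.wordSpan_mono n.zero_le (Submodule.one_le.mp le_rfl)

theorem mul_mem_wordSpan {u w : TensorEnd R A} {m n : ℕ} (hu : u ∈ S.wordSpan m)
    (hw : w ∈ S.wordSpan n) : u * w ∈ S.wordSpan (m + n) := by
  rw [wordSpan, pow_add]
  exact Submodule.mul_mem_mul hu hw

theorem pow_mem_wordSpan {u : TensorEnd R A} {m : ℕ} (hu : u ∈ S.wordSpan m) (n : ℕ) :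
    u ^ n ∈ S.wordSpan (m * n) := by
  rw [wordSpan, pow_mul]
  exact Submodule.pow_mem_pow _ hu n

theorem a_mem_wordSpan : S.a ∈ S.wordSpan 1 := by
  rw [wordSpan, pow_one]
  exact Submodule.subset_span (by simp)

theorem t_mem_wordSpan : S.t ∈ S.wordSpan 1 := by
  rw [wordSpan, pow_one]
  exact Submodule.subset_span (by simp)

theorem wordSpan_succ_le {n : ℕ} {W : Submodule R (TensorEnd R A)} (mem : ∀ u ∈ S.wordSpan n, u ∈ W)
    (a_mul_mem : ∀ u ∈ S.wordSpan n, S.a * u ∈ W) (t_mul_mem : ∀ u ∈ S.wordSpan n, S.t * u ∈ W) :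
    S.wordSpan (n + 1) ≤ W := by
  rw [wordSpan, pow_succ', ← wordSpan]
  refine Submodule.mul_le.mpr fun g hg u hu => ?_
  suffices h : Submodule.span R {1, S.a, S.t} ≤ W.comap (LinearMap.mulRight R u) from h hg
  refine Submodule.span_le.mpr ?_
  rintro _ (rfl | rfl | rfl)
  · simpa using mem u hu
  · exact a_mul_mem u hu
  · exact t_mul_mem u hu

theorem coord_of_three_le {p : ℕ} (hp : 3 ≤ p) (u : TensorEnd R A) : S.coord p u = 0 := by
  rw [coord_apply, S.coef_of_three_le hp, map_zero, zero_mul]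

theorem coord_a_mul (p : ℕ) (u : TensorEnd R A) :
    S.coord p (S.a * u) = (p + 1 : R) • S.coord (p + 1) u := by
  rw [coord_apply, a_eq, ← mul_assoc, ← mul_assoc, contractHead_mul_consMap, one_mul, coef_comp_d,
    map_smul, smul_mul_assoc, smul_mul_assoc, mul_assoc, ← coord_apply]

theorem coord_x_pow_letterMul_mul {p i : ℕ} (hp : p < 3) (u w : TensorEnd R A) :
    S.coord p (S.x ^ i ⊠ u * w) = if i ≤ p then u * S.coord (p - i) w else 0 := by
  have head : contractHead (S.coef p) * S.x ^ i ⊠ u =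
      u * contractHead (if i ≤ p then S.coef (p - i) else 0) := by
    rw [← S.coef_comp_x_pow_mul hp]
    exact contractHead_mul_consMap _ _ _
  rw [coord_apply, ← mul_assoc, ← mul_assoc, head]
  split_ifs
  · rw [mul_assoc, mul_assoc, ← coord_apply]
  · rw [map_zero, mul_zero, zero_mul, zero_mul]

theorem coord_t_mul {p : ℕ} (hp : p < 3) (u : TensorEnd R A) : S.coord p (S.t * u) =
    (if 1 ≤ p then S.a * S.coord (p - 1) u else 0) +
      if 2 ≤ p then S.t * S.coord (p - 2) u else 0 := by
  conv_lhs => rw [S.t_eq, ← pow_one S.x, ← pow_mul, add_mul, map_add]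
  rw [S.coord_x_pow_letterMul_mul hp, S.coord_x_pow_letterMul_mul hp]

theorem coord_mem_wordSpan {n : ℕ} : ∀ {u : TensorEnd R A}, u ∈ S.wordSpan n →
    ∀ p, S.coord p u ∈ S.wordSpan ((n + p) / 2) := by
  induction n with
  | zero =>
    intro u hu p
    obtain ⟨c, rfl⟩ := Submodule.mem_one.mp hu
    rw [Algebra.algebraMap_eq_smul_one, map_smul, coord_one]
    exact Submodule.smul_mem _ _ (Submodule.smul_mem _ _ (S.one_mem_wordSpan _))
  | succ n ih =>
    intro u hu p
    rcases lt_or_ge p 3 with hp | hp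
    swap
    · rw [coord_of_three_le _ hp]
      exact Submodule.zero_mem _
    suffices h : S.wordSpan (n + 1) ≤ (S.wordSpan ((n + 1 + p) / 2)).comap (S.coord p) from h hu
    refine S.wordSpan_succ_le (fun u hu => ?_) (fun u hu => ?_) fun u hu => ?_
    · exact S.wordSpan_mono (by omega) (ih hu p)
    · rw [Submodule.mem_comap, coord_a_mul, add_assoc, add_comm 1 p]
      exact Submodule.smul_mem _ _ (ih hu (p + 1))
    · rw [Submodule.mem_comap, S.coord_t_mul hp]
      refine Submodule.add_mem _ ?_ ?_ <;> split_ifs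
      · exact S.wordSpan_mono (by omega) (S.mul_mem_wordSpan S.a_mem_wordSpan (ih hu (p - 1)))
      · exact Submodule.zero_mem _
      · exact S.wordSpan_mono (by omega) (S.mul_mem_wordSpan S.t_mem_wordSpan (ih hu (p - 2)))
      · exact Submodule.zero_mem _

variable {S}

theorem exists_mem_wordSpan {z : TensorEnd R A} (hz : z ∈ S.lieAlgebra) :
    ∃ n, z ∈ S.wordSpan n := by
  induction hz using LieSubalgebra.lieSpan_induction with
  | mem g hg =>
    rcases hg with rfl | rfl
    exacts [⟨1, S.a_mem_wordSpan⟩, ⟨1, S.t_mem_wordSpan⟩]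
  | zero => exact ⟨0, Submodule.zero_mem _⟩
  | add u w _ _ hu hw =>
    obtain ⟨⟨m, hu⟩, n, hw⟩ := And.intro hu hw
    exact ⟨max m n, Submodule.add_mem _ (S.wordSpan_mono (le_max_left m n) hu)
      (S.wordSpan_mono (le_max_right m n) hw)⟩
  | smul c u _ hu =>
    obtain ⟨n, hu⟩ := hu
    exact ⟨n, Submodule.smul_mem _ c hu⟩
  | lie u w _ _ hu hw =>
    obtain ⟨⟨m, hu⟩, n, hw⟩ := And.intro hu hw
    exact ⟨m + n, Submodule.sub_mem _ (S.mul_mem_wordSpan hu hw)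
      (add_comm m n ▸ S.mul_mem_wordSpan hw hu)⟩

theorem apply_one {z : TensorEnd R A} (hz : z ∈ S.lieAlgebra) : z 1 = 0 := by
  induction hz using LieSubalgebra.lieSpan_induction with
  | mem g hg =>
    rcases hg with rfl | rfl
    · rw [a_eq, consMap_one]
    · rw [t_eq, LinearMap.add_apply, letterMul_one, letterMul_one, add_zero]
  | zero => rfl
  | add u w _ _ hu hw => rw [LinearMap.add_apply, hu, hw, add_zero]
  | smul c u _ hu => rw [LinearMap.smul_apply, hu, smul_zero]
  | lie u w _ _ hu hw =>
    rw [LieRing.of_associative_ring_bracket, LinearMap.sub_apply, Module.End.mul_apply,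
      Module.End.mul_apply, hu, hw, map_zero, map_zero, sub_zero]

theorem eq_zero_of_mem_wordSpan_zero {z : TensorEnd R A} (hz : z ∈ S.lieAlgebra)
    (hz₀ : z ∈ S.wordSpan 0) : z = 0 := by
  obtain ⟨c, rfl⟩ := Submodule.mem_one.mp hz₀
  have c_eq_zero := apply_one hz
  rw [Module.algebraMap_end_apply, ← Algebra.algebraMap_eq_smul_one] at c_eq_zero
  rw [(TensorAlgebra.algebraMap_leftInverse A).injective.eq_iff' (map_zero _)] at c_eq_zero
  rw [c_eq_zero, map_zero]

theorem isNilpotent_of_coord_zero {z : TensorEnd R A} (hz : z ∈ S.tIdeal)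
    (h : IsNilpotent (S.coord 0 z)) : IsNilpotent z := by
  obtain ⟨⟨z₀, z₁, z₂⟩, -, rfl⟩ := S.tIdeal_le_coordSubspace hz
  rw [coord_zero_ofCoord] at h
  exact S.isNilpotent_ofCoord z₁ z₂ h

theorem coord_zero_mem {z : TensorEnd R A} (hz : z ∈ S.tIdeal) :
    S.coord 0 z ∈ S.lieAlgebra := by
  obtain ⟨⟨z₀, z₁, z₂⟩, ⟨h₀, -⟩, rfl⟩ := S.tIdeal_le_coordSubspace hz
  rwa [coord_zero_ofCoord]

theorem isNilpotent_of_mem_wordSpan {n : ℕ} : ∀ {z : TensorEnd R A}, z ∈ S.lieAlgebra →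
    z ∈ S.wordSpan n → IsNilpotent z := by
  induction n using Nat.strong_induction_on with
  | _ n ih =>
    intro z hz hzn
    rcases n.eq_zero_or_pos with rfl | n_pos
    · rw [eq_zero_of_mem_wordSpan_zero hz hzn]
      exact IsNilpotent.zero
    have cube_coord_mem : S.coord 0 (z ^ 3) ∈ S.tIdeal := S.coord_zero_pow_three_mem_tIdeal hz
    have mem_wordSpan : S.coord 0 (S.coord 0 (z ^ 3)) ∈ S.wordSpan ((n * 3 / 2) / 2) :=
      S.coord_mem_wordSpan (S.coord_mem_wordSpan (S.pow_mem_wordSpan hzn 3) 0) 0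
    have cube_coord_nilpotent : IsNilpotent (S.coord 0 (z ^ 3)) :=
      isNilpotent_of_coord_zero cube_coord_mem
        (ih _ (by omega) (coord_zero_mem cube_coord_mem) mem_wordSpan)
    exact (isNilpotent_of_coord_zero (S.derived_le_tIdeal (S.pow_three_mem_derived hz))
      cube_coord_nilpotent).of_pow

theorem isNilpotent_of_mem {z : TensorEnd R A} (hz : z ∈ S.lieAlgebra) : IsNilpotent z := by
  obtain ⟨n, hn⟩ := exists_mem_wordSpan hz
  exact isNilpotent_of_mem_wordSpan hz hn

end Model

/-! ### Operators without polynomial identities -/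

section Identities

variable {R V X : Type*} [CommRing R] [AddCommGroup V] [Module R V]

/-- On the vectors `v 0, …, v n` the operators `e k` act as the matrix units `E_{k,k+1}`. -/
def ActsAsMatrixUnits (e : ℕ → Module.End R V) (v : ℕ → V) (n : ℕ) : Prop :=
  ∀ k, ∀ j ≤ n, e k (v j) = if j = k + 1 then v k else 0

section Words

variable [DecidableEq X]

/-- The substitution that sends a letter to the sum of the `e k` over the positions `k` of the
letter in the word `w`. When the `e k` are matrix units, `w` takes the value
`E_{0,1} E_{1,2} ⋯ = E_{0,|w|}`. -/
def wordSubst (e : ℕ → Module.End R V) (w : List X) (i : X) : Module.End R V :=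
  ∑ k ∈ Finset.range w.length with w[k]? = some i, e k

variable {e : ℕ → Module.End R V} {v : ℕ → V} {n : ℕ}

theorem wordSubst_apply_zero (h : ActsAsMatrixUnits e v n) (w : List X) (i : X) :
    wordSubst e w i (v 0) = 0 := by
  rw [wordSubst, LinearMap.sum_apply]
  exact Finset.sum_eq_zero fun k _ => by rw [h k 0 n.zero_le, if_neg k.succ_ne_zero.symm]

theorem wordSubst_apply_succ (h : ActsAsMatrixUnits e v n) {w : List X} (i : X) {j : ℕ}
    (hj : j < w.length) (hjn : j < n) :
    wordSubst e w i (v (j + 1)) = if w[j] = i then v j else 0 := by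
  rw [wordSubst, LinearMap.sum_apply]
  simp only [h _ (j + 1) hjn, Nat.add_right_cancel_iff, Finset.sum_ite_eq, Finset.mem_filter,
    Finset.mem_range, hj, List.getElem?_eq_getElem, Option.some_inj, true_and]

theorem prod_wordSubst_apply {w : List X} (h : ActsAsMatrixUnits e v w.length) {l : List X} {j : ℕ}
    (hjw : j ≤ w.length) (hjl : j ≤ l.length) :
    (l.map (wordSubst e w)).prod (v j) = if l = w.take j then v 0 else 0 := by
  induction l using List.reverseRecOn generalizing j with
  | nil =>
    obtain rfl : j = 0 := Nat.le_zero.mp hjl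
    simp
  | append_singleton l i ih =>
    rw [List.map_append, List.prod_append, List.map_singleton, List.prod_singleton,
      Module.End.mul_apply]
    rcases j with - | j
    · rw [wordSubst_apply_zero h, map_zero, List.take_zero, if_neg (by simp)]
    · have append_eq_take : l ++ [i] = w.take (j + 1) ↔ l = w.take j ∧ w[j] = i := by
        rw [← List.take_append_getElem hjw, List.append_singleton_inj, eq_comm (a := i)]
      rw [wordSubst_apply_succ h i hjw hjw]
      by_cases hi : w[j] = i
      · rw [if_pos hi, ih (by omega) (by simpa using hjl)]
        simp only [append_eq_take, hi, and_true]
      · rw [if_neg hi, map_zero, if_neg fun hl => hi (append_eq_take.mp hl).2]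

end Words

theorem lift_eq_sum {B : Type*} [Ring B] [Algebra R B] (f : X → B) (P : FreeAlgebra R X) :
    FreeAlgebra.lift R f P =
      (FreeAlgebra.equivMonoidAlgebraFreeMonoid P).coeff.sum fun l c =>
        c • (l.toList.map f).prod := by
  have lift_eq : FreeAlgebra.lift R f =
      (MonoidAlgebra.lift R B (FreeMonoid X) (FreeMonoid.lift f)).comp
        (FreeAlgebra.equivMonoidAlgebraFreeMonoid (R := R) (X := X)).toAlgHom := by
    ext i
    simp [FreeAlgebra.equivMonoidAlgebraFreeMonoid]
  rw [lift_eq, AlgHom.comp_apply, MonoidAlgebra.lift_apply]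
  simp only [FreeMonoid.lift_apply]
  rfl

theorem exists_lift_ne_zero [IsDomain R] [Module.IsTorsionFree R V]
    {L : Submodule R (Module.End R V)} {e : ℕ → Module.End R V} (he : ∀ k, e k ∈ L)
    (hv : ∀ n, ∃ v, v 0 ≠ 0 ∧ ActsAsMatrixUnits e v n) {P : FreeAlgebra R X} (hP : P ≠ 0) :
    ∃ f : X → Module.End R V, (∀ i, f i ∈ L) ∧ FreeAlgebra.lift R f P ≠ 0 := by
  classical
  set q := (FreeAlgebra.equivMonoidAlgebraFreeMonoid P).coeff
  have support_nonempty : q.support.Nonempty := by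
    rw [Finsupp.support_nonempty_iff, Ne, MonoidAlgebra.coeff_eq_zero]
    exact (map_ne_zero_iff _ FreeAlgebra.equivMonoidAlgebraFreeMonoid.injective).mpr hP
  obtain ⟨w, hw, w_minimal⟩ :=
    q.support.exists_min_image (fun l => l.toList.length) support_nonempty
  obtain ⟨v, v_ne_zero, h⟩ := hv w.toList.length
  let f : X → Module.End R V := wordSubst e w.toList
  refine ⟨f, fun i => Submodule.sum_mem _ fun k _ => he k, fun lift_eq_zero => ?_⟩
  have lift_apply : FreeAlgebra.lift R f P (v w.toList.length) = q w • v 0 :=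
    calc FreeAlgebra.lift R f P (v w.toList.length)
      _ = ∑ l ∈ q.support, q l • (l.toList.map f).prod (v w.toList.length) := by
          rw [lift_eq_sum, Finsupp.sum, LinearMap.sum_apply]
          rfl
      _ = ∑ l ∈ q.support, if l = w then q l • v 0 else 0 := by
          refine Finset.sum_congr rfl fun l hl => ?_
          simp only [f, prod_wordSubst_apply h le_rfl (w_minimal l hl), List.take_length, smul_ite,
            smul_zero, FreeMonoid.toList.apply_eq_iff_eq]
      _ = q w • v 0 := by rw [Finset.sum_ite_eq_of_mem' _ _ _ hw]
  refine smul_ne_zero (Finsupp.mem_support_iff.mp hw) v_ne_zero ?_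
  rw [← lift_apply, lift_eq_zero, LinearMap.zero_apply]

end Identities

/-! ### The Engel polynomials -/

section Engel

variable (R : Type*) [CommRing R]

/-- The Lie polynomial `ad(X₀)ⁿ(X₁)`. -/
def engel (n : ℕ) : FreeAlgebra R ℕ :=
  (LieAlgebra.ad R (FreeAlgebra R ℕ) (FreeAlgebra.ι R 0) ^ n) (FreeAlgebra.ι R 1)

theorem lift_engel {A : Type*} [Ring A] [Algebra R A] (f : ℕ → A) (n : ℕ) :
    FreeAlgebra.lift R f (engel R n) = (LieAlgebra.ad R A (f 0) ^ n) (f 1) := by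
  induction n with
  | zero => simp [engel]
  | succ n ih =>
    rw [engel, pow_succ', pow_succ', Module.End.mul_apply, Module.End.mul_apply, ← ih,
      LieAlgebra.ad_apply, LieAlgebra.ad_apply, ← engel]
    simp only [LieRing.of_associative_ring_bracket, map_sub, map_mul, FreeAlgebra.lift_ι_apply]

theorem engel_ne_zero [Nontrivial R] (n : ℕ) : engel R n ≠ 0 := by
  let E (j : Fin 2) : Matrix (Fin 2) (Fin 2) R := Matrix.single 0 j 1
  have ad_pow : (LieAlgebra.ad R _ (E 0) ^ n) (E 1) = E 1 := by
    induction n with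
    | zero => rfl
    | succ n ih =>
      rw [pow_succ', Module.End.mul_apply, ih, LieAlgebra.ad_apply,
        LieRing.of_associative_ring_bracket]
      simp [E]
  intro engel_eq_zero
  have lift_eq := lift_engel R (fun i => if i = 0 then E 0 else E 1) n
  rw [engel_eq_zero, map_zero, if_pos rfl, if_neg one_ne_zero, ad_pow] at lift_eq
  simpa [E] using congrFun (congrFun lift_eq 0) 1

end Engel

/-! ### Matrix units in the Gupta–Sidki Lie algebra -/

namespace Model

open TensorAlgebra

variable {R A : Type*} [CommRing R] [CommRing A] [Algebra R A] (S : Model R A)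

/-- The elements `1 ⊗ ⋯ ⊗ 1 ⊗ x ⊗ [a, t]` of the Lie algebra, with `2k + 1` factors `1`. They act
as the matrix units `E_{k,k+1}` on the tensors `marked n j`. -/
def matrixUnit : ℕ → TensorEnd R A
  | 0 => 1 ⊠ S.x ⊠ ⁅S.a, S.t⁆
  | k + 1 => 1 ⊠ 1 ⊠ matrixUnit k

/-- The tensor `x² ⊗ y`. -/
def block (y : A) : TensorAlgebra R A :=
  ι R (S.x ^ 2) * ι R y

/-- The tensor with `n + 1` factors `x² ⊗ 1`, except that the factor with index `j ≤ n` is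
`x² ⊗ x`. -/
def marked (n j : ℕ) : TensorAlgebra R A :=
  S.block 1 ^ j * (S.block S.x * S.block 1 ^ (n - j))

theorem matrixUnit_mem_derived (k : ℕ) : S.matrixUnit k ∈ S.derived := by
  induction k with
  | zero => exact S.letterMul_mem_derived _ (S.letterMul_mem_derived _ S.commutator_mem_derived)
  | succ k ih => exact S.letterMul_mem_derived _ (S.letterMul_mem_derived _ ih)

theorem marked_zero (n : ℕ) : S.marked n 0 = S.block S.x * S.block 1 ^ n := by
  rw [marked, pow_zero, one_mul, Nat.sub_zero]

theorem marked_succ_succ (n j : ℕ) : S.marked (n + 1) (j + 1) = S.block 1 * S.marked n j := by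
  rw [marked, marked, pow_succ', mul_assoc, Nat.add_sub_add_right]

theorem one_letterMul_letterMul_block_mul (y z : A) (u : TensorEnd R A) (v : TensorAlgebra R A) :
    (1 ⊠ y ⊠ u) (S.block z * v) = S.block (y * z) * u v := by
  rw [block, block, mul_assoc, mul_assoc, letterMul_ι_mul, letterMul_ι_mul, one_mul]

theorem commutator_block_mul (y : A) (v : TensorAlgebra R A) :
    ⁅S.a, S.t⁆ (S.block y * v) = S.block (S.d y) * v := by
  rw [a_lie_t, a_eq, block, block, mul_assoc, mul_assoc, LinearMap.sub_apply, letterMul_ι_mul,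
    letterMul_ι_mul, ← pow_succ', S.x_pow_three, map_zero, zero_mul, sub_zero, one_mul,
    consMap_ι_mul]
  rfl

theorem commutator_block_one_mul (v : TensorAlgebra R A) :
    ⁅S.a, S.t⁆ (S.block 1 * v) = 0 := by
  rw [commutator_block_mul, S.d.map_one_eq_zero, block, map_zero, mul_zero, zero_mul]

theorem commutator_block_one_pow (n : ℕ) : ⁅S.a, S.t⁆ (S.block 1 ^ n) = 0 := by
  rcases n with - | n
  · rw [pow_zero, apply_one (S.mem_of_mem_derived S.commutator_mem_derived)]
  · rw [pow_succ', commutator_block_one_mul]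

theorem matrixUnit_block_one_pow (k n : ℕ) : S.matrixUnit k (S.block 1 ^ n) = 0 := by
  induction k generalizing n with
  | zero =>
    rcases n with - | n
    · rw [matrixUnit, pow_zero, letterMul_one]
    · rw [matrixUnit, pow_succ', one_letterMul_letterMul_block_mul, commutator_block_one_pow,
        mul_zero]
  | succ k ih =>
    rcases n with - | n
    · rw [matrixUnit, pow_zero, letterMul_one]
    · rw [matrixUnit, pow_succ', one_letterMul_letterMul_block_mul, ih, mul_zero]

theorem actsAsMatrixUnits_marked (n : ℕ) : ActsAsMatrixUnits S.matrixUnit (S.marked n) n := by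
  intro k
  induction k generalizing n with
  | zero =>
    intro j hj
    rcases j with - | j
    · rw [matrixUnit, marked_zero, one_letterMul_letterMul_block_mul, commutator_block_one_pow,
        mul_zero, if_neg (by decide)]
    obtain ⟨n, rfl⟩ := Nat.exists_eq_add_of_le' (Nat.one_le_of_lt hj)
    rw [matrixUnit, marked_succ_succ, one_letterMul_letterMul_block_mul, mul_one]
    rcases j with - | j
    · rw [marked_zero, commutator_block_mul, S.d_x, if_pos rfl, marked_zero, pow_succ']
    · rw [marked, pow_succ', mul_assoc, commutator_block_one_mul, mul_zero, if_neg (by omega)]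
  | succ k ih =>
    intro j hj
    rcases j with - | j
    · rw [matrixUnit, marked_zero, one_letterMul_letterMul_block_mul, matrixUnit_block_one_pow,
        mul_zero, if_neg (by omega)]
    obtain ⟨n, rfl⟩ := Nat.exists_eq_add_of_le' (Nat.one_le_of_lt hj)
    rw [matrixUnit, marked_succ_succ, one_letterMul_letterMul_block_mul, mul_one,
      ih n j (Nat.le_of_succ_le_succ hj), marked_succ_succ, mul_ite, mul_zero]
    simp only [Nat.add_right_cancel_iff]

theorem ι_x_pow_ne_zero [Nontrivial R] {i : ℕ} (hi : i < 3) : ι R (S.x ^ i) ≠ 0 := by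
  rw [← S.basis_apply ⟨i, hi⟩, Ne, ι_eq_zero_iff]
  exact S.basis.ne_zero _

theorem block_x_pow_ne_zero [IsDomain R] {i : ℕ} (hi : i < 3) : S.block (S.x ^ i) ≠ 0 :=
  have : Module.Free R A := .of_basis S.basis
  mul_ne_zero (S.ι_x_pow_ne_zero (by decide)) (S.ι_x_pow_ne_zero hi)

theorem marked_zero_ne_zero [IsDomain R] (n : ℕ) : S.marked n 0 ≠ 0 := by
  have : Module.Free R A := .of_basis S.basis
  rw [marked_zero, ← pow_one S.x, ← pow_zero S.x]
  exact mul_ne_zero (S.block_x_pow_ne_zero (by decide))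
    (pow_ne_zero n (S.block_x_pow_ne_zero (by decide)))

theorem exists_lift_ne_zero [IsDomain R] {X : Type*} {P : FreeAlgebra R X} (hP : P ≠ 0) :
    ∃ f : X → TensorEnd R A, (∀ i, f i ∈ S.lieAlgebra) ∧ FreeAlgebra.lift R f P ≠ 0 :=
  have : Module.Free R A := .of_basis S.basis
  GuptaSidki.exists_lift_ne_zero (L := S.lieAlgebra.toSubmodule)
    (fun k => S.mem_of_mem_derived (S.matrixUnit_mem_derived k))
    (fun n => ⟨S.marked n, S.marked_zero_ne_zero n, S.actsAsMatrixUnits_marked n⟩) hP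

end Model

namespace Model

variable {R A : Type*} [CommRing R] [IsDomain R] [CommRing A] [Algebra R A] (S : Model R A)

theorem exists_pow_ne_zero (n : ℕ) : ∃ z ∈ S.lieAlgebra, z ^ n ≠ 0 := by
  obtain ⟨f, hf, hne⟩ :=
    S.exists_lift_ne_zero (pow_ne_zero n (FreeAlgebra.ι_ne_zero (R := R) (0 : ℕ)))
  rw [map_pow, FreeAlgebra.lift_ι_apply] at hne
  exact ⟨f 0, hf 0, hne⟩

theorem exists_ad_pow_ne_zero (n : ℕ) :
    ∃ z : S.lieAlgebra, LieAlgebra.ad R S.lieAlgebra z ^ n ≠ 0 := by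
  obtain ⟨f, hf, hne⟩ := S.exists_lift_ne_zero (engel_ne_zero R n)
  refine ⟨⟨f 0, hf 0⟩, fun ad_pow_eq_zero => hne ?_⟩
  have h := LieSubalgebra.coe_ad_pow R _ S.lieAlgebra ⟨f 0, hf 0⟩ ⟨f 1, hf 1⟩ n
  rw [ad_pow_eq_zero] at h
  rw [lift_engel]
  exact h.symm

theorem not_isNilpotent_lieAlgebra : ¬ LieRing.IsNilpotent S.lieAlgebra := fun _ => by
  obtain ⟨n, hn⟩ := LieAlgebra.nilpotent_ad_of_nilpotent_algebra R S.lieAlgebra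
  obtain ⟨z, hz⟩ := S.exists_ad_pow_ne_zero n
  exact hz (hn z)

end Model

/-! ### The alphabet `𝔽₃[x]/(x³)` -/

theorem x_pow_three : x ^ 3 = 0 := by
  rw [x, AdjoinRoot.root, ← map_pow, AdjoinRoot.mk_self]

theorem dx_x : dx x = 1 := by
  rw [x, AdjoinRoot.root, dx_mk, Polynomial.derivative_X, map_one]

/-- The basis `1, x, x ^ 2` of the alphabet. -/
def xPowBasis : Module.Basis (Fin 3) (ZMod 3) Alphabet :=
  (AdjoinRoot.powerBasis' (Polynomial.monic_X_pow 3)).basis.reindex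
    (finCongr (Polynomial.natDegree_X_pow 3))

theorem xPowBasis_apply (i : Fin 3) : xPowBasis i = x ^ (i : ℕ) := by
  rw [xPowBasis, Module.Basis.reindex_apply, PowerBasis.basis_eq_pow]
  rfl

theorem opA_eq_consMap : opA = consMap dx.toLinearMap 1 :=
  tensorAlgebra_hom_ext (by simp [opA_one]) fun y v => by simp [opA_cons]

theorem opT_eq_letterMul : opT = x ⊠ opA + x ^ 2 ⊠ opT :=
  tensorAlgebra_hom_ext (by simp [opT_one]) fun y v => by simp [opT_cons]

/-- The operators `a` and `t` of the Gupta–Sidki Lie algebra over `𝔽₃`. -/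
def standardModel : Model (ZMod 3) Alphabet where
  three_eq_zero := CharP.cast_eq_zero (ZMod 3) 3
  x := x
  x_pow_three := x_pow_three
  basis := xPowBasis
  basis_apply := xPowBasis_apply
  d := dx
  d_x := dx_x
  a := opA
  t := opT
  a_eq := opA_eq_consMap
  t_eq := opT_eq_letterMul

end

end GuptaSidki

theorem mainTheorem2_general {R A : Type*} [CommRing R] [IsDomain R] [CommRing A] [Algebra R A]
    (S : GuptaSidki.Model R A) :
    (∀ z ∈ S.lieAlgebra, z ^ 3 ∈ S.lieAlgebra) ∧
    (∀ z ∈ S.lieAlgebra, ∃ n : ℕ, z ^ 3 ^ n = 0) ∧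
    (∀ z : S.lieAlgebra, IsNilpotent (LieAlgebra.ad R S.lieAlgebra z)) ∧
    (∀ n : ℕ, ∃ z ∈ S.lieAlgebra, z ^ 3 ^ n ≠ 0) ∧
    (∀ n : ℕ, ∃ z : S.lieAlgebra, LieAlgebra.ad R S.lieAlgebra z ^ n ≠ 0) ∧
    ¬ LieRing.IsNilpotent S.lieAlgebra ∧
    ∀ P : FreeAlgebra R ℕ, P ≠ 0 →
      ∃ f : ℕ → GuptaSidki.TensorEnd R A,
        (∀ i, f i ∈ S.lieAlgebra) ∧ FreeAlgebra.lift R f P ≠ 0 := by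
  refine ⟨fun z hz => S.mem_of_mem_derived (S.pow_three_mem_derived hz), fun z hz => ?_,
    fun z => LieAlgebra.isNilpotent_ad_of_isNilpotent
      (GuptaSidki.Model.isNilpotent_of_mem z.2),
    fun n => S.exists_pow_ne_zero (3 ^ n), S.exists_ad_pow_ne_zero,
    S.not_isNilpotent_lieAlgebra, fun P => S.exists_lift_ne_zero⟩
  obtain ⟨n, hn⟩ := GuptaSidki.Model.isNilpotent_of_mem hz
  exact ⟨n, pow_eq_zero_of_le (Nat.lt_pow_self (by norm_num)).le hn⟩

theorem mainTheorem2 :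
    -- `L` is a restricted Lie algebra, the `3`-mapping being `z ↦ z³`
    (∀ z ∈ GuptaSidki.gsLie, z ^ 3 ∈ GuptaSidki.gsLie) ∧
    -- `L` is nil: every element is nil for the `3`-mapping, and every `ad z` is nilpotent
    (∀ z ∈ GuptaSidki.gsLie, ∃ n : ℕ, z ^ 3 ^ n = 0) ∧
    (∀ z : GuptaSidki.gsLie, IsNilpotent (LieAlgebra.ad (ZMod 3) GuptaSidki.gsLie z)) ∧
    -- the nillity is unbounded, in both senses
    (∀ n : ℕ, ∃ z ∈ GuptaSidki.gsLie, z ^ 3 ^ n ≠ 0) ∧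
    (∀ n : ℕ, ∃ z : GuptaSidki.gsLie, LieAlgebra.ad (ZMod 3) GuptaSidki.gsLie z ^ n ≠ 0) ∧
    -- `L` is not nilpotent, and not even PI
    ¬ LieRing.IsNilpotent GuptaSidki.gsLie ∧
    ¬ GuptaSidki.gsLie.IsPI := by
  have h := mainTheorem2_general GuptaSidki.standardModel
  refine ⟨h.1, h.2.1, h.2.2.1, h.2.2.2.1, h.2.2.2.2.1, h.2.2.2.2.2.1, ?_⟩
  rintro ⟨P, -, hP, vanishes⟩
  obtain ⟨f, hf, lift_ne_zero⟩ := h.2.2.2.2.2.2 P hP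
  exact lift_ne_zero (vanishes f hf)
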